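/- Let $p\ge 3$, let $q\ge 1$ be odd, and let $k,\ell,n\ge 0$ be integers. Let $\mathbb R_{0,m}$, $m=p+q$, be the real Clifford algebra generated by $e_1,\dots,e_m$ with $e_ie_j+e_je_i=-2\delta_{ij}$. For $(x,y)\in\mathbb R^p\oplus\mathbb R^q$ identify $x=\sum_{j\le p}x_je_j$ and $y=\sum_{j\le q}y_je_{p+j}$ with elements of $\mathbb R_{0,m}$, and put $r=|x|$, $\rho=|y|$, $\omega=x/r$, $\nu=y/\rho$. Let $C_j=C_j^{\lambda}$ with $\lambda=(p-2)/2$ be the Gegenbauer polynomials: $C_0=1$, $C_1(t)=2\lambda t$, $jC_j(t)=2(j+\lambda-1)tC_{j-1}(t)-(j+2\lambda-2)C_{j-2}(t)$ for $j\ge2$. A polynomial $P$ on $\mathbb R^d$ with Clifford algebra values is called monogenic if $\sum_j e_j\partial_jP=0$. Let $P_k(x)$ and $P_\ell(y)$ be homogeneous monogenic polynomials on $\mathbb R^p$ and $\mathbb R^q$ of degrees $k$ and $\ell$, with values in the even subalgebras of the Clifford algebras generated by $e_1,\dots,e_p$ and by $e_{p+1},\dots,e_m$ respectively. For $h=u+iv$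 holomorphic in the upper half-plane, put $$A(r,\rho)=\frac{r^{-k}}{C_k(1)}\int_{-1}^1u(rt,\rho)\,C_k(t)\,(1-t^2)^{\frac{p-3}2}\,dt,\qquad B(r,\rho)=\frac{r^{-k}}{C_{k+1}(1)}\int_{-1}^1v(rt,\rho)\,C_{k+1}(t)\,(1-t^2)^{\frac{p-3}2}\,dt,$$ and define on $\{(x,y): y\ne0\}$ the Fueter-Funk-Hecke transform $$\mathsf{Ft}_{p,q}[h,P_k,P_\ell](x,y)=(\Delta_x+\Delta_y)^{\ell+\frac{q-1}2}\Big(\big(A(r,\rho)-\omega\,\nu\,B(r,\rho)\big)P_k(x)P_\ell(y)\Big),$$ where at $x=0$ one puts $\omega=0$ and, if $k\ge1$, $A=B=0$ (for $h(z)=z^n$ this is the continuous extension). Let $h(z)=z^n$. (a) If $k-n$ is odd, then $\mathsf{Ft}_{p,q}[z^n,P_k,P_\ell](x,y)=0$ for all $(x,y)$ with $y\neq 0$. (b) If $k-n$ is even, then there is a polynomial $H$ with real coefficients in two non-commuting variables, depending only on $p,q,k,\ell,n$ and not on the choice of $P_k$, $P_\ell$, such that $$\mathsf{Ft}_{p,q}[z^n,P_k,P_\ell](x,y)=H(x,y)\,P_k(x)\,P_\ell(y)\qquad\text{for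 all }(x,y)\text{ with }y\ne0,$$ where $H(x,y)\in\mathbb R_{0,m}$ is obtained by substituting the vectors $x,y$ for the variables. Here $H$ is homogeneous of degree $n-(k+2\ell+q-1)$ if $n\ge k+2\ell+q-1$, and $H=0$ if $n<k+2\ell+q-1$. (The zero polynomial counts as homogeneous of every degree.) -/

import Mathlib

open Laplacian InnerProductSpace

noncomputable section

/-! ### Norm on real Clifford algebras

A real Clifford algebra of a finite-dimensional space is finite-dimensional. We equip it with the
norm of its coordinates in a basis. All norms on a finite-dimensional real space are equivalent, so
the choice does not affect the partial derivatives of functions with values in the algebra. -/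

instance cliffordFinite {M : Type*} [AddCommGroup M] [Module ℝ M] [Module.Finite ℝ M]
    (Q : QuadraticForm ℝ M) : Module.Finite ℝ (CliffordAlgebra Q) :=
  Module.Finite.of_basis
    ((Module.finBasis ℝ M).ExteriorAlgebra.map (CliffordAlgebra.equivExterior Q).symm)

instance cliffordNormedAddCommGroup {M : Type*} [AddCommGroup M] [Module ℝ M] [Module.Finite ℝ M]
    (Q : QuadraticForm ℝ M) : NormedAddCommGroup (CliffordAlgebra Q) :=
  NormedAddCommGroup.induced (CliffordAlgebra Q) _
    (Module.finBasis ℝ (CliffordAlgebra Q)).equivFun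
    (Module.finBasis ℝ (CliffordAlgebra Q)).equivFun.injective

instance cliffordNormedSpace {M : Type*} [AddCommGroup M] [Module ℝ M] [Module.Finite ℝ M]
    (Q : QuadraticForm ℝ M) : NormedSpace ℝ (CliffordAlgebra Q) :=
  NormedSpace.induced ℝ (CliffordAlgebra Q) _
    (Module.finBasis ℝ (CliffordAlgebra Q)).equivFun

/-! ### The Clifford algebras of `ℝⁿ` and of `ℝᵖ ⊕ ℝ^q` -/

/-- Euclidean space `ℝⁿ`. -/
abbrev Vec (n : ℕ) : Type := EuclideanSpace ℝ (Fin n)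

/-- The negative definite quadratic form `x ↦ -|x|²` on `ℝⁿ`. -/
def negSq (n : ℕ) : QuadraticForm ℝ (Vec n) :=
  -(LinearMap.BilinMap.toQuadraticMap (innerₗ (Vec n)))

theorem negSq_apply (n : ℕ) (x : Vec n) : negSq n x = -‖x‖ ^ 2 := by
  simp [negSq]

/-- The real Clifford algebra generated by `e₁, …, eₙ` with `eⱼ eₖ + eₖ eⱼ = -2 δⱼₖ`. -/
abbrev Cl (n : ℕ) : Type := CliffordAlgebra (negSq n)

/-- The real Clifford algebra of `ℝᵐ = ℝᵖ ⊕ ℝ^q`, with the form `(x, y) ↦ -|x|² - |y|²`. -/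
abbrev BiCl (p q : ℕ) : Type := CliffordAlgebra ((negSq p).prod (negSq q))

/-- A vector `x ∈ ℝᵖ` as an element of the Clifford algebra of `ℝᵖ ⊕ ℝ^q`. -/
def vecX (p q : ℕ) (x : Vec p) : BiCl p q :=
  CliffordAlgebra.ι ((negSq p).prod (negSq q)) (x, 0)

/-- A vector `y ∈ ℝ^q` as an element of the Clifford algebra of `ℝᵖ ⊕ ℝ^q`. -/
def vecY (p q : ℕ) (y : Vec q) : BiCl p q :=
  CliffordAlgebra.ι ((negSq p).prod (negSq q)) (0, y)

/-- The inclusion of the Clifford algebra of `ℝᵖ` into that of `ℝᵖ ⊕ ℝ^q`. -/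
def inclX (p q : ℕ) : Cl p →ₐ[ℝ] BiCl p q :=
  CliffordAlgebra.map (QuadraticMap.Isometry.inl (negSq p) (negSq q))

/-- The inclusion of the Clifford algebra of `ℝ^q` into that of `ℝᵖ ⊕ ℝ^q`. -/
def inclY (p q : ℕ) : Cl q →ₐ[ℝ] BiCl p q :=
  CliffordAlgebra.map (QuadraticMap.Isometry.inr (negSq p) (negSq q))

/-! ### Homogeneous monogenic polynomials -/

/-- The Dirac operator `∑ⱼ eⱼ ∂_{xⱼ}` on `ℝⁿ`. -/
def dirac (n : ℕ) (f : Vec n → Cl n) (x : Vec n) : Cl n :=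
  ∑ j : Fin n, CliffordAlgebra.ι (negSq n) (EuclideanSpace.single j 1) *
    lineDeriv ℝ f x (EuclideanSpace.single j 1)

/-- `P` is a polynomial function on `ℝⁿ`, homogeneous of degree `k`, with coefficients in the
Clifford algebra. -/
def IsHomogeneousPoly (n k : ℕ) (P : Vec n → Cl n) : Prop :=
  ∃ c : (Fin n → ℕ) → Cl n, ∀ x : Vec n,
    P x = ∑ α ∈ Finset.piAntidiag (Finset.univ : Finset (Fin n)) k, (∏ i, x i ^ α i) • c α

/-- `P` is a homogeneous monogenic polynomial of degree `k` on `ℝⁿ` with values in the even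
subalgebra. -/
structure IsEvenMonogenicPoly (n k : ℕ) (P : Vec n → Cl n) : Prop where
  homogeneous : IsHomogeneousPoly n k P
  monogenic : ∀ x, dirac n P x = 0
  even : ∀ x, P x ∈ CliffordAlgebra.even (negSq n)

/-! ### The Fueter-Funk-Hecke transform -/

/-- The Gegenbauer polynomial `C_k^lam`, defined by its three-term recurrence. -/
def gegenbauer (lam : ℝ) : ℕ → ℝ → ℝ
  | 0, _ => 1
  | 1, t => 2 * lam * t
  | k + 2, t => 1 / ((k : ℝ) + 2) * (2 * ((k : ℝ) + 1 + lam) * t * gegenbauer lam (k + 1) t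
      - ((k : ℝ) + 2 * lam) * gegenbauer lam k t)

/-- The Gegenbauer polynomial of degree `k` attached to `ℝᵖ`, with `λ = (p - 2) / 2`. -/
def gegen (p k : ℕ) (t : ℝ) : ℝ := gegenbauer (((p : ℝ) - 2) / 2) k t

/-- The function `A(r, ρ)` attached to `h = u + i v`. -/
def partA (p k : ℕ) (h : ℂ → ℂ) (r ρ : ℝ) : ℝ :=
  (gegen p k 1)⁻¹ * (r ^ k)⁻¹ *
    ∫ t in (-1 : ℝ)..1, (h ⟨r * t, ρ⟩).re * gegen p k t * (1 - t ^ 2) ^ (((p : ℝ) - 3) / 2)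

/-- The function `B(r, ρ)` attached to `h = u + i v`. -/
def partB (p k : ℕ) (h : ℂ → ℂ) (r ρ : ℝ) : ℝ :=
  (gegen p (k + 1) 1)⁻¹ * (r ^ k)⁻¹ *
    ∫ t in (-1 : ℝ)..1, (h ⟨r * t, ρ⟩).im * gegen p (k + 1) t *
      (1 - t ^ 2) ^ (((p : ℝ) - 3) / 2)

/-- The operator `Δ_x + Δ_y` on functions of `(x, y) ∈ ℝᵖ ⊕ ℝ^q`. -/
def biLaplacian (p q : ℕ) (F : Vec p → Vec q → BiCl p q) : Vec p → Vec q → BiCl p q :=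
  fun x y => Δ (fun x' : Vec p => F x' y) x + Δ (fun y' : Vec q => F x y') y

/-- `(A(r, ρ) - ω ν B(r, ρ)) P(x) P'(y)`, where `r = |x|`, `ρ = |y|`, `ω = x / r`, `ν = y / ρ`.

At `x = 0` Lean's convention `0⁻¹ = 0` gives `ω = 0` and, for `k ≥ 1`, `A = B = 0`. -/
def ffhSeed (p q k : ℕ) (h : ℂ → ℂ) (P : Vec p → Cl p) (P' : Vec q → Cl q)
    (x : Vec p) (y : Vec q) : BiCl p q :=
  (algebraMap ℝ (BiCl p q) (partA p k h ‖x‖ ‖y‖)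
      - partB p k h ‖x‖ ‖y‖ • (vecX p q (‖x‖⁻¹ • x) * vecY p q (‖y‖⁻¹ • y)))
    * (inclX p q (P x) * inclY p q (P' y))

/-- The Fueter-Funk-Hecke transform `Ft_{p,q}[h, P, P']` for `q` odd and polynomials `P`, `P'` of
degrees `k`, `l`: the operator `Δ_x + Δ_y` applied `l + (q - 1) / 2` times to the function above. -/
def Ft (p q k l : ℕ) (h : ℂ → ℂ) (P : Vec p → Cl p) (P' : Vec q → Cl q) :
    Vec p → Vec q → BiCl p q :=
  (biLaplacian p q)^[l + (q - 1) / 2] (ffhSeed p q k h P P')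

/-! ### Real polynomials in the two vector variables -/

/-- Polynomials with real coefficients in two non-commuting variables, homogeneous of degree `d`:
the linear span of the words of length `d`. -/
def homogeneousPart (d : ℕ) : Submodule ℝ (FreeAlgebra ℝ (Fin 2)) :=
  Submodule.span ℝ (Set.range (FreeAlgebra.ι ℝ)) ^ d

/-- The value `H(x, y)` of a real polynomial in two non-commuting variables at the vectors `x`, `y`
of the Clifford algebra. -/
def evalVec (p q : ℕ) (H : FreeAlgebra ℝ (Fin 2)) (x : Vec p) (y : Vec q) : BiCl p q :=
  FreeAlgebra.lift ℝ ![vecX p q x, vecY p q y] H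

end

open scoped ContDiff

/-! ### Moments of Gegenbauer polynomials -/

/-! For `h(z) = zⁿ`, expanding `(rt + iρ)ⁿ` turns `A` and `B` into sums of monomials `r^(n-m) ρ^m`
weighted by moments `∫ t^s C_j(t) (1 - t²)^((p-3)/2) dt`, with `j = k` for `A` and `j = k + 1` for
`B`. A moment vanishes when `s < j` (orthogonality) or when `j + s` is odd, while `Re iᵐ` and `Im
iᵐ` select the parity of `m`. If `k - n` is odd, nothing survives and (a) follows. If it is even,
then up to the factor `r^(-k) r^k`, which `P_k` absorbs, `A` is a sum of terms `r^(2i) ρ^(2j)` with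
`i + j = (n-k)/2`, and `-B` is `rρ` times such a sum with `i + j = (n-k)/2 - 1`.

Since `rρ ων = xy` and `y` commutes with the even element `P_k(x)`, the seed is a sum of terms
`|x|^(2i) |y|^(2j) f(x) g(y)` with `(f, g) = (P_k, P_ℓ)` or `(xP_k, yP_ℓ)` (`ffhSeed_pow_of_even`).
Monogenicity makes all four factors harmonic, and they satisfy Euler's identity, so `Δ(|x|^(2i) f)`
is a scalar multiple of `|x|^(2i-2) f`. The total Laplacian therefore preserves the shape, lowers `i
+ j` by one and acts on the coefficients alone (`biLaplacian_harmonicSum`).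

After `ℓ + (q-1)/2` applications the sums are empty or have total degree `n - (k + 2ℓ + q - 1)`
relative to `P_k P_ℓ`. Replacing `|x|²`, `|y|²` by `-x²`, `-y²` gives `H`, whose coefficients never
involve `P_k` or `P_ℓ`. -/

theorem gegenbauer_continuous (lam : ℝ) (k : ℕ) : Continuous (gegenbauer lam k) := by
  induction k using Nat.twoStepInduction with
  | zero => simpa only [gegenbauer] using continuous_const
  | one => simp only [gegenbauer]; fun_prop
  | more k h₀ h₁ => simp only [gegenbauer]; fun_prop

/-- The weight `(1 - t²)^((p - 3) / 2)` attached to `ℝᵖ`. -/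
noncomputable def gegenWeight (p : ℕ) (t : ℝ) : ℝ := (1 - t ^ 2) ^ (((p : ℝ) - 3) / 2)

theorem gegenWeight_continuous {p : ℕ} (hp : 3 ≤ p) : Continuous (gegenWeight p) := by
  have : (3 : ℝ) ≤ p := by exact_mod_cast hp
  exact (by fun_prop : Continuous fun t : ℝ => 1 - t ^ 2).rpow_const
    fun t => Or.inr (by linarith)

/-- The moment `∫ tˢ C_k(t) (1 - t²)^((p - 3) / 2) dt` over `[-1, 1]`. -/
noncomputable def gegenMoment (p k s : ℕ) : ℝ :=
  ∫ t in (-1 : ℝ)..1, t ^ s * gegen p k t * gegenWeight p t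

theorem gegenMoment_intervalIntegrable {p : ℕ} (hp : 3 ≤ p) (k s : ℕ) :
    IntervalIntegrable (fun t => t ^ s * gegen p k t * gegenWeight p t)
      MeasureTheory.volume (-1) 1 :=
  (((continuous_id.pow s).mul (gegenbauer_continuous _ k)).mul
    (gegenWeight_continuous hp)).intervalIntegrable _ _

theorem gegenMoment_one {p : ℕ} (s : ℕ) :
    gegenMoment p 1 s = ((p : ℝ) - 2) * gegenMoment p 0 (s + 1) := by
  rw [gegenMoment, gegenMoment, ← intervalIntegral.integral_const_mul]
  refine intervalIntegral.integral_congr fun t _ => ?_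
  simp only [gegen, gegenbauer]
  ring

/-- The three-term recurrence integrated against `t^s`, with `2λ = p - 2`. -/
theorem gegenMoment_add_two {p : ℕ} (hp : 3 ≤ p) (k s : ℕ) :
    ((k : ℝ) + 2) * gegenMoment p (k + 2) s =
      (2 * k + p) * gegenMoment p (k + 1) (s + 1) - ((k : ℝ) + p - 2) * gegenMoment p k s := by
  simp only [gegenMoment]
  rw [← intervalIntegral.integral_const_mul, ← intervalIntegral.integral_const_mul,
    ← intervalIntegral.integral_const_mul, ← intervalIntegral.integral_sub
      ((gegenMoment_intervalIntegrable hp _ _).const_mul _)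
      ((gegenMoment_intervalIntegrable hp _ _).const_mul _)]
  refine intervalIntegral.integral_congr fun t _ => ?_
  have : (k : ℝ) + 2 ≠ 0 := by positivity
  simp only [gegen, gegenbauer]
  field_simp
  ring

/-- Integrate the derivative of `t^(s+1) (1 - t²)^((p-1)/2)`, which vanishes at both endpoints. -/
theorem gegenMoment_zero_add_two {p : ℕ} (hp : 3 ≤ p) (s : ℕ) :
    ((s : ℝ) + p) * gegenMoment p 0 (s + 2) = (s + 1) * gegenMoment p 0 s := by
  have hp' : (3 : ℝ) ≤ p := by exact_mod_cast hp
  have hderiv : ∀ t ∈ Set.uIcc (-1 : ℝ) 1,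
      HasDerivAt (fun t : ℝ => t ^ (s + 1) * (1 - t ^ 2) ^ (((p : ℝ) - 1) / 2))
        ((s + 1) * (t ^ s * gegen p 0 t * gegenWeight p t)
          - (s + p) * (t ^ (s + 2) * gegen p 0 t * gegenWeight p t)) t := by
    intro t ht
    rw [Set.uIcc_of_le (by norm_num), Set.mem_Icc] at ht
    have h1 : HasDerivAt (fun t : ℝ => 1 - t ^ 2) (-(2 * t)) t := by
      simpa using ((hasDerivAt_pow 2 t).const_sub 1)
    have h2 := h1.rpow_const (p := ((p : ℝ) - 1) / 2) (Or.inr (by linarith))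
    refine ((hasDerivAt_pow (s + 1) t).mul h2).congr_deriv ?_
    have e1 : ((p : ℝ) - 1) / 2 - 1 = ((p : ℝ) - 3) / 2 := by ring
    have e2 : (1 - t ^ 2) ^ (((p : ℝ) - 1) / 2)
        = (1 - t ^ 2) ^ (((p : ℝ) - 3) / 2) * (1 - t ^ 2) := by
      rw [show ((p : ℝ) - 1) / 2 = ((p : ℝ) - 3) / 2 + 1 by ring]
      have h0 : 0 ≤ 1 - t ^ 2 := by nlinarith
      rw [Real.rpow_add_of_nonneg h0 (by linarith) (by norm_num), Real.rpow_one]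
    rw [e1, e2]
    simp only [gegenWeight, gegen, gegenbauer, Nat.add_sub_cancel]
    push_cast
    ring
  have hI (r : ℕ) := gegenMoment_intervalIntegrable hp 0 r
  have key := intervalIntegral.integral_eq_sub_of_hasDerivAt hderiv
    (((hI s).const_mul _).sub ((hI (s + 2)).const_mul _))
  rw [intervalIntegral.integral_sub ((hI s).const_mul _) ((hI (s + 2)).const_mul _),
    intervalIntegral.integral_const_mul, intervalIntegral.integral_const_mul] at key
  have h0 : (0 : ℝ) ^ (((p : ℝ) - 1) / 2) = 0 := Real.zero_rpow (by linarith)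
  norm_num [h0] at key
  simp only [gegenMoment]
  linarith

theorem gegenMoment_zero_of_odd {p s : ℕ} (hs : Odd s) : gegenMoment p 0 s = 0 := by
  have h := intervalIntegral.integral_comp_neg (a := (-1 : ℝ)) (b := 1)
    fun t => t ^ s * gegen p 0 t * gegenWeight p t
  simp only [gegen, gegenbauer, gegenWeight, hs.neg_pow, even_two.neg_pow, neg_mul, neg_neg,
    intervalIntegral.integral_neg] at h
  simp only [gegenMoment, gegen, gegenbauer, gegenWeight]
  linarith

/-- The recurrence in the degree involves two lower degrees. Carrying the diagonal relation together
with the two-step relation in `s` closes the induction using level `k` alone. The last three clauses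
are the boundary cases `s = 0, 1`; the factors `k` and `k - 1` encode the exceptions `k = 0` and `k
= 1` without case splits. -/
theorem gegenMoment_relations {p : ℕ} (hp : 3 ≤ p) (k : ℕ) :
    (∀ s : ℕ, ((k : ℝ) + 1) * (s + k + p) * gegenMoment p (k + 1) (s + 1)
      = (k + p - 2) * (s + 1) * gegenMoment p k s) ∧
    (∀ s : ℕ, ((s : ℝ) - k + 2) * (s + k + p) * gegenMoment p k (s + 2)
      = (s + 2) * (s + 1) * gegenMoment p k s) ∧
    (k : ℝ) * gegenMoment p k 0 = 0 ∧ gegenMoment p (k + 1) 0 = 0 ∧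
    ((k : ℝ) - 1) * gegenMoment p k 1 = 0 := by
  have hp' : (3 : ℝ) ≤ p := by exact_mod_cast hp
  induction k with
  | zero =>
    have h := gegenMoment_zero_add_two hp
    refine ⟨fun s => ?_, fun s => ?_, by simp, ?_, ?_⟩
    · rw [gegenMoment_one]
      push_cast
      linear_combination ((p : ℝ) - 2) * h s
    · push_cast
      linear_combination ((s : ℝ) + 2) * h s
    · rw [gegenMoment_one, gegenMoment_zero_of_odd (by decide), mul_zero]
    · rw [gegenMoment_zero_of_odd (by decide), mul_zero]
  | succ k ih =>
    obtain ⟨h1, h2, h3, h4, h5⟩ := ih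
    have hk : (k : ℝ) + 1 ≠ 0 := by positivity
    have hk2 : (k : ℝ) + 2 ≠ 0 := by positivity
    have hpos (s : ℕ) : (s : ℝ) + k + p ≠ 0 := by positivity
    refine ⟨fun s => ?_, fun s => ?_, by rw [h4, mul_zero], ?_, ?_⟩
    · cases s with
      | zero =>
        have a := gegenMoment_add_two hp k 1
        have b := h1 1
        have hp1 := hpos 1
        rw [h4]
        push_cast at a b hp1 ⊢
        -- After clearing denominators, what is left is a multiple of `(k - 1)` times the first
        -- moment of `C_k`, which `h5` kills.
        refine mul_left_cancel₀ (mul_ne_zero hk hp1) ?_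
        linear_combination (k + 1 + p) * (k + 1) * (1 + k + p) * a
          + (k + 1 + p) * (2 * k + p) * b - (k + 1 + p) * (k + p - 2) * (k + p - 1) * h5
      | succ s =>
        have a := gegenMoment_add_two hp k (s + 2)
        have b := h1 (s + 2)
        have c := h1 s
        have d := h2 s
        -- `b` and `c` trade the moments of `C_{k+1}` for moments of `C_k` of orders `s + 2` and
        -- `s`, and `d` relates these two.
        refine mul_left_cancel₀ (mul_ne_zero hk (hpos s)) ?_
        push_cast at a b c d ⊢
        linear_combination (k + 1) * (s + k + p) * (s + k + 2 + p) * a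
          + (s + k + p) * (2 * k + p) * b - (k + p - 1) * (s + 2) * c
          + (k + p - 1) * (k + p - 2) * d
    · cases s with
      | zero =>
        have b := h1 1
        rw [h4]
        push_cast at b ⊢
        refine mul_left_cancel₀ hk ?_
        linear_combination (1 - k) * b - 2 * (k + p - 2) * h5
      | succ s =>
        have b := h1 (s + 2)
        have c := h1 s
        have d := h2 s
        refine mul_left_cancel₀ (mul_ne_zero hk (hpos s)) ?_
        push_cast at b c d ⊢
        linear_combination (s - k + 2) * (s + k + p) * b - (s + 3) * (s + 2) * c
          + (k + p - 2) * (s + 3) * d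
    · have a := gegenMoment_add_two hp k 0
      have b := h1 0
      have hp0 := hpos 0
      push_cast at a b hp0
      refine (mul_eq_zero.1 (?_ : (((k : ℝ) + 2) * (k + 1) * (0 + k + p))
        * gegenMoment p (k + 1 + 1) 0 = 0)).resolve_left (mul_ne_zero (mul_ne_zero hk2 hk) hp0)
      linear_combination (k + 1) * (0 + k + p) * a + (2 * k + p) * b
        + (k + p - 2) * (1 - k - p) * h3
    · have b := h1 0
      have hp0 := hpos 0
      push_cast at b hp0 ⊢
      refine mul_left_cancel₀ (mul_ne_zero hk hp0) ?_
      linear_combination k * b + (k + p - 2) * h3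

theorem gegenMoment_succ_succ {p : ℕ} (hp : 3 ≤ p) (k s : ℕ) :
    gegenMoment p (k + 1) (s + 1)
      = (k + p - 2) * (s + 1) / ((k + 1) * (s + k + p)) * gegenMoment p k s := by
  have : (s : ℝ) + k + p ≠ 0 := by positivity
  have h := (gegenMoment_relations hp k).1 s
  field_simp
  linear_combination h

/-- The Gegenbauer polynomial `C_k` is orthogonal to the powers `tˢ` with `s < k`. -/
theorem gegenMoment_of_lt {p : ℕ} (hp : 3 ≤ p) {k s : ℕ} (hs : s < k) : gegenMoment p k s = 0 := by
  induction s generalizing k with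
  | zero =>
    obtain ⟨k, rfl⟩ := Nat.exists_eq_add_one_of_ne_zero hs.ne'
    exact (gegenMoment_relations hp k).2.2.2.1
  | succ s ih =>
    obtain ⟨k, rfl⟩ := Nat.exists_eq_add_one_of_ne_zero (Nat.ne_zero_of_lt hs)
    rw [gegenMoment_succ_succ hp, ih (by omega), mul_zero]

/-- The diagonal relation preserves the parity of `k + s` and descends to `C_0`, where the integrand
is odd, or to `s = 0`, where orthogonality applies. -/
theorem gegenMoment_of_odd {p : ℕ} (hp : 3 ≤ p) {k s : ℕ} (h : Odd (k + s)) :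
    gegenMoment p k s = 0 := by
  induction k generalizing s with
  | zero => exact gegenMoment_zero_of_odd (by simpa using h)
  | succ k ih =>
    cases s with
    | zero => exact gegenMoment_of_lt hp (by omega)
    | succ s => rw [gegenMoment_succ_succ hp, ih (by rw [Nat.odd_iff] at *; omega), mul_zero]

/-! ### Laplacians of solid harmonics -/

section Harmonic

variable {n : ℕ} {F G : Type*} [NormedAddCommGroup F] [NormedSpace ℝ F]
  [NormedAddCommGroup G] [NormedSpace ℝ G]

theorem laplacian_eq_sum_fderiv {f : Vec n → F} (hf : ContDiff ℝ ∞ f) (x : Vec n) :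
    Δ f x = ∑ i, fderiv ℝ (fun z => fderiv ℝ f z (EuclideanSpace.single i 1)) x
      (EuclideanSpace.single i 1) := by
  rw [laplacian_eq_iteratedFDeriv_orthonormalBasis f (EuclideanSpace.basisFun (Fin n) ℝ)]
  refine Finset.sum_congr rfl fun i _ => ?_
  have hd : DifferentiableAt ℝ (fderiv ℝ f) x :=
    ((hf.fderiv_right (m := ∞) (by simp)).differentiable (by simp)) x
  rw [iteratedFDeriv_two_apply, fderiv_clm_apply hd (by fun_prop)]
  simp

theorem fderiv_coord_smul {g : Vec n → F} (hg : Differentiable ℝ g) (j : Fin n) (x v : Vec n) :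
    fderiv ℝ (fun z => z j • g z) x v = x j • fderiv ℝ g x v + v j • g x := by
  have hc : HasFDerivAt (fun z : Vec n => z j) (EuclideanSpace.proj j : Vec n →L[ℝ] ℝ) x :=
    (EuclideanSpace.proj j : Vec n →L[ℝ] ℝ).hasFDerivAt
  rw [(hc.fun_smul (hg x).hasFDerivAt).fderiv]
  simp

theorem contDiff_coord_smul {g : Vec n → F} (hg : ContDiff ℝ ∞ g) (j : Fin n) :
    ContDiff ℝ ∞ fun z => z j • g z :=
  ((EuclideanSpace.proj j : Vec n →L[ℝ] ℝ).contDiff).smul hg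

theorem contDiff_fderiv_apply {g : Vec n → F} (hg : ContDiff ℝ ∞ g) (v : Vec n) :
    ContDiff ℝ ∞ fun z => fderiv ℝ g z v :=
  (hg.fderiv_right (m := ∞) (by simp)).clm_apply contDiff_const

theorem laplacian_coord_smul {g : Vec n → F} (hg : ContDiff ℝ ∞ g) (j : Fin n) (x : Vec n) :
    Δ (fun z => z j • g z) x
      = (2 : ℝ) • fderiv ℝ g x (EuclideanSpace.single j 1) + x j • Δ g x := by
  have hd := hg.differentiable (by simp)
  rw [laplacian_eq_sum_fderiv (contDiff_coord_smul hg j), laplacian_eq_sum_fderiv hg]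
  have h (i : Fin n) : fderiv ℝ (fun z => fderiv ℝ (fun z => z j • g z) z
      (EuclideanSpace.single i 1)) x (EuclideanSpace.single i 1)
      = x j • fderiv ℝ (fun z => fderiv ℝ g z (EuclideanSpace.single i 1)) x
          (EuclideanSpace.single i 1)
        + (if j = i then (2 : ℝ) • fderiv ℝ g x (EuclideanSpace.single i 1) else 0) := by
    have hd' := (contDiff_fderiv_apply hg (EuclideanSpace.single i (1 : ℝ))).differentiable
      (by simp)
    simp only [fderiv_coord_smul hd]
    rw [fderiv_fun_add ((contDiff_coord_smul (contDiff_fderiv_apply hg _) j).differentiable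
      (by simp) x) ((hd x).fun_const_smul _), add_apply, fderiv_coord_smul hd',
      fderiv_fun_const_smul (hd x)]
    rcases eq_or_ne j i with rfl | hij
    · simp [two_smul, add_assoc]
    · simp [hij]
  simp only [h, Finset.sum_add_distrib, Finset.sum_ite_eq, Finset.mem_univ, if_true,
    Finset.smul_sum]
  rw [add_comm]

theorem laplacian_fun_add {f g : Vec n → F} (hf : ContDiff ℝ ∞ f) (hg : ContDiff ℝ ∞ g)
    (x : Vec n) : Δ (fun z => f z + g z) x = Δ f x + Δ g x :=
  ContDiffAt.laplacian_add (contDiff_infty.1 hf 2).contDiffAt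
    (contDiff_infty.1 hg 2).contDiffAt

theorem laplacian_fun_const_smul {f : Vec n → F} (hf : ContDiff ℝ ∞ f) (c : ℝ)
    (x : Vec n) : Δ (fun z => c • f z) x = c • Δ f x :=
  laplacian_smul c (contDiff_infty.1 hf 2).contDiffAt

theorem laplacian_clm_comp {f : Vec n → F} (hf : ContDiff ℝ ∞ f) (L : F →L[ℝ] G)
    (x : Vec n) : Δ (fun z => L (f z)) x = L (Δ f x) :=
  ContDiffAt.laplacian_CLM_comp_left (contDiff_infty.1 hf 2).contDiffAt

theorem laplacian_fun_sum {ι : Type*} (s : Finset ι) {f : ι → Vec n → F}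
    (hf : ∀ i ∈ s, ContDiff ℝ ∞ (f i)) (x : Vec n) :
    Δ (fun z => ∑ i ∈ s, f i z) x = ∑ i ∈ s, Δ (f i) x := by
  classical
  induction s using Finset.induction_on with
  | empty => simp
  | insert a s ha ih =>
    simp only [Finset.sum_insert ha]
    rw [laplacian_fun_add (hf a (Finset.mem_insert_self _ _))
      (ContDiff.sum fun i hi => hf i (Finset.mem_insert_of_mem hi)),
      ih fun i hi => hf i (Finset.mem_insert_of_mem hi)]

theorem euclidean_sum_smul_single (x : Vec n) :
    ∑ j, x j • EuclideanSpace.single j (1 : ℝ) = x := by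
  simpa using (EuclideanSpace.basisFun (Fin n) ℝ).sum_repr x

/-- Write `|z|²` as `∑ z_j²` and apply the product rule for one coordinate twice; the cross terms
add up to the radial derivative. -/
theorem laplacian_normSq_smul {g : Vec n → F} (hg : ContDiff ℝ ∞ g) (x : Vec n) :
    Δ (fun z => ‖z‖ ^ 2 • g z) x
      = (2 * n : ℝ) • g x + (4 : ℝ) • fderiv ℝ g x x + ‖x‖ ^ 2 • Δ g x := by
  have hd := hg.differentiable (by simp)
  have hn (z : Vec n) : ‖z‖ ^ 2 • g z = ∑ j, z j • (z j • g z) := by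
    rw [EuclideanSpace.real_norm_sq_eq, Finset.sum_smul]
    simp only [smul_smul, sq]
  simp only [hn]
  rw [laplacian_fun_sum _ fun j _ => contDiff_coord_smul (contDiff_coord_smul hg j) j]
  simp only [laplacian_coord_smul (contDiff_coord_smul hg _), laplacian_coord_smul hg,
    fderiv_coord_smul hd]
  have he : fderiv ℝ g x x = ∑ j, x j • fderiv ℝ g x (EuclideanSpace.single j 1) := by
    have h := congrArg (fderiv ℝ g x) (euclidean_sum_smul_single x)
    simpa only [map_sum, map_smul] using h.symm
  rw [he, EuclideanSpace.real_norm_sq_eq, Finset.smul_sum, Finset.sum_smul]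
  have hc : (2 * n : ℝ) • g x = ∑ _j : Fin n, (2 : ℝ) • g x := by
    simp [mul_comm, mul_smul, Nat.cast_smul_eq_nsmul]
  rw [hc, ← Finset.sum_add_distrib, ← Finset.sum_add_distrib]
  refine Finset.sum_congr rfl fun j _ => ?_
  simp
  module

/-- A smooth function on `ℝⁿ` that is harmonic and satisfies Euler's identity of degree `d`. -/
structure IsSolidHarmonic (d : ℕ) (f : Vec n → F) : Prop where
  contDiff : ContDiff ℝ ∞ f
  laplacian_eq_zero : ∀ x, Δ f x = 0
  fderiv_self : ∀ x, fderiv ℝ f x x = (d : ℝ) • f x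

theorem IsSolidHarmonic.clm_comp {d : ℕ} {f : Vec n → F} (hf : IsSolidHarmonic d f)
    (L : F →L[ℝ] G) : IsSolidHarmonic d fun x => L (f x) where
  contDiff := L.contDiff.comp hf.contDiff
  laplacian_eq_zero x := by rw [laplacian_clm_comp hf.contDiff, hf.laplacian_eq_zero, map_zero]
  fderiv_self x := by
    have h := (L.hasFDerivAt.comp x (hf.contDiff.differentiable (by simp) x).hasFDerivAt).fderiv
    rw [show (fun x => L (f x)) = L ∘ f from rfl, h]
    simp [hf.fderiv_self]

theorem contDiff_normSq_pow_smul {g : Vec n → F} (hg : ContDiff ℝ ∞ g) (i : ℕ) :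
    ContDiff ℝ ∞ fun z => (‖z‖ ^ 2) ^ i • g z :=
  ((contDiff_norm_sq ℝ).pow i).smul hg

theorem fderiv_normSq_smul_self {g : Vec n → F} (hg : Differentiable ℝ g) (x : Vec n) :
    fderiv ℝ (fun z => ‖z‖ ^ 2 • g z) x x = ‖x‖ ^ 2 • ((2 : ℝ) • g x + fderiv ℝ g x x) := by
  have h1 := (hasStrictFDerivAt_norm_sq x).hasFDerivAt
  rw [(h1.fun_smul (hg x).hasFDerivAt).fderiv]
  simp
  module

theorem IsSolidHarmonic.fderiv_normSq_pow_smul {d : ℕ} {f : Vec n → F} (hf : IsSolidHarmonic d f)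
    (i : ℕ) (x : Vec n) :
    fderiv ℝ (fun z => (‖z‖ ^ 2) ^ i • f z) x x = (2 * i + d : ℝ) • (‖x‖ ^ 2) ^ i • f x := by
  induction i with
  | zero => simp [hf.fderiv_self]
  | succ i ih =>
    simp only [pow_succ' _ i, mul_smul]
    rw [fderiv_normSq_smul_self
      ((contDiff_normSq_pow_smul hf.contDiff i).differentiable (by simp)), ih]
    push_cast
    module

/-- `Δ(|x|^(2i) f) = 2i(2i + n - 2 + 2d) |x|^(2i-2) f` for a solid harmonic `f` of degree `d`. -/
theorem IsSolidHarmonic.laplacian_normSq_pow_smul {d : ℕ} {f : Vec n → F}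
    (hf : IsSolidHarmonic d f) (i : ℕ) (x : Vec n) :
    Δ (fun z => (‖z‖ ^ 2) ^ i • f z) x
      = (2 * i * (2 * i + n - 2 + 2 * d) : ℝ) • (‖x‖ ^ 2) ^ (i - 1) • f x := by
  induction i with
  | zero => simp [hf.laplacian_eq_zero]
  | succ i ih =>
    simp only [pow_succ' _ i, mul_smul]
    rw [laplacian_normSq_smul (contDiff_normSq_pow_smul hf.contDiff i), ih,
      hf.fderiv_normSq_pow_smul]
    -- The truncated exponent `i - 1` is harmless at `i = 0`, because its coefficient is zero there.
    cases i with
    | zero => simp; module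
    | succ i =>
      simp only [Nat.add_sub_cancel, pow_succ']
      push_cast
      module

end Harmonic

/-! ### Monogenic polynomials are solid harmonics -/

section Monogenic

/-- Left multiplication in a finite-dimensional algebra as a continuous linear map. -/
noncomputable def mulLeftCLM {p : ℕ} (a : Cl p) : Cl p →L[ℝ] Cl p :=
  (LinearMap.mulLeft ℝ a).toContinuousLinearMap

@[simp] theorem mulLeftCLM_apply {p : ℕ} (a b : Cl p) : mulLeftCLM a b = a * b := rfl

variable {n k : ℕ} {P : Vec n → Cl n}

theorem IsHomogeneousPoly.contDiff (hP : IsHomogeneousPoly n k P) : ContDiff ℝ ∞ P := by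
  obtain ⟨c, hc⟩ := hP
  rw [funext hc]
  refine ContDiff.sum fun α _ => ContDiff.fun_smul (contDiff_prod fun i _ => ?_) contDiff_const
  exact ((EuclideanSpace.proj i : Vec n →L[ℝ] ℝ).contDiff).pow _

theorem IsHomogeneousPoly.map_smul (hP : IsHomogeneousPoly n k P) (t : ℝ) (x : Vec n) :
    P (t • x) = t ^ k • P x := by
  obtain ⟨c, hc⟩ := hP
  rw [hc, hc, Finset.smul_sum]
  refine Finset.sum_congr rfl fun α hα => ?_
  rw [smul_smul, ← (Finset.mem_piAntidiag.1 hα).1, ← Finset.prod_pow_eq_pow_sum,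
    ← Finset.prod_mul_distrib]
  simp [mul_pow]

theorem IsHomogeneousPoly.fderiv_self (hP : IsHomogeneousPoly n k P) (x : Vec n) :
    fderiv ℝ P x x = (k : ℝ) • P x := by
  have hd : HasFDerivAt P (fderiv ℝ P ((1 : ℝ) • x)) ((1 : ℝ) • x) :=
    (hP.contDiff.differentiable (by simp) _).hasFDerivAt
  have h1 := hd.comp_hasDerivAt (1 : ℝ) ((hasDerivAt_id (1 : ℝ)).smul_const x)
  have h2 := (hasDerivAt_pow k (1 : ℝ)).smul_const (P x)
  rw [show (P ∘ fun y : ℝ => id y • x) = fun t : ℝ => t ^ k • P x from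
    funext fun t => hP.map_smul t x] at h1
  simpa using h1.unique h2

/-- The generator `e_j` of the Clifford algebra of `ℝⁿ`. -/
noncomputable def cliffordGen (n : ℕ) (j : Fin n) : Cl n :=
  CliffordAlgebra.ι (negSq n) (EuclideanSpace.single j 1)

theorem cliffordGen_anticomm (i j : Fin n) :
    cliffordGen n i * cliffordGen n j + cliffordGen n j * cliffordGen n i
      = algebraMap ℝ (Cl n) (if i = j then -2 else 0) := by
  rw [cliffordGen, cliffordGen, CliffordAlgebra.ι_mul_ι_add_swap]
  congr 1
  rw [QuadraticMap.polar, negSq_apply, negSq_apply, negSq_apply, norm_add_sq_real]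
  split_ifs with h
  · subst h
    simp
  · simp [EuclideanSpace.inner_single_left, h]

theorem ι_eq_sum_cliffordGen (x : Vec n) :
    CliffordAlgebra.ι (negSq n) x = ∑ j, x j • cliffordGen n j := by
  have h := congrArg (CliffordAlgebra.ι (negSq n)) (euclidean_sum_smul_single x)
  simpa only [map_sum, map_smul, cliffordGen] using h.symm

theorem dirac_eq_sum_fderiv (hP : Differentiable ℝ P) (x : Vec n) :
    dirac n P x = ∑ j, cliffordGen n j * fderiv ℝ P x (EuclideanSpace.single j 1) :=
  Finset.sum_congr rfl fun j _ => by rw [(hP x).lineDeriv_eq_fderiv]; rfl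

theorem fderiv_comm_apply (hP : ContDiff ℝ ∞ P) (x v w : Vec n) :
    fderiv ℝ (fun z => fderiv ℝ P z v) x w = fderiv ℝ (fun z => fderiv ℝ P z w) x v := by
  have hd : DifferentiableAt ℝ (fderiv ℝ P) x :=
    ((hP.fderiv_right (m := ∞) (by simp)).differentiable (by simp)) x
  rw [fderiv_clm_apply hd (by fun_prop), fderiv_clm_apply hd (by fun_prop)]
  have hs : IsSymmSndFDerivAt ℝ P x := 
    (contDiff_infty.1 hP 2).contDiffAt.isSymmSndFDerivAt (by simp)
  simpa using hs.eq w v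

/-- A monogenic function is harmonic. -/
theorem laplacian_eq_zero_of_dirac_eq_zero (hP : ContDiff ℝ ∞ P) (h : ∀ x, dirac n P x = 0)
    (x : Vec n) : Δ P x = 0 := by
  set e := cliffordGen n
  set D : Fin n → Fin n → Cl n := fun i j =>
    fderiv ℝ (fun z => fderiv ℝ P z (EuclideanSpace.single j 1)) x (EuclideanSpace.single i 1)
  have hD (i j) : D i j = D j i := fderiv_comm_apply hP _ _ _
  -- Differentiate the Dirac equation in the direction `e_i`.
  have h0 (i : Fin n) : ∑ j, e j * D i j = 0 := by
    have hz : (fun z => ∑ j, mulLeftCLM (e j) (fderiv ℝ P z (EuclideanSpace.single j 1)))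
        = fun _ => 0 :=
      funext fun z => (dirac_eq_sum_fderiv (hP.differentiable (by simp)) z).symm.trans (h z)
    have hj (j : Fin n) := (mulLeftCLM (e j)).hasFDerivAt.comp x
      ((contDiff_fderiv_apply hP (EuclideanSpace.single j (1 : ℝ))).differentiable
        (by simp) x).hasFDerivAt
    have hs := (HasFDerivAt.fun_sum fun j (_ : j ∈ Finset.univ) => hj j).fderiv
    simp only [Function.comp_def, hz, fderiv_const_apply] at hs
    have := congrArg (fun T => T (EuclideanSpace.single i (1 : ℝ))) hs
    simpa using this.symm
  have h1 : ∑ i, ∑ j, e i * (e j * D i j) = 0 := by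
    simp only [← Finset.mul_sum, h0, mul_zero, Finset.sum_const_zero]
  have h2 : ∑ i, ∑ j, e j * (e i * D i j) = 0 := by
    rw [Finset.sum_comm, ← h1]
    exact Finset.sum_congr rfl fun i _ => Finset.sum_congr rfl fun j _ => by rw [hD]
  -- Adding the double sum to its transpose brings in the anticommutators, so only the diagonal
  -- survives: the square of the Dirac operator is `-Δ`.
  have h3 : ∑ i, ∑ j, (algebraMap ℝ (Cl n) (if i = j then -2 else 0)) * D i j = 0 := by
    simp only [← cliffordGen_anticomm, add_mul, mul_assoc, Finset.sum_add_distrib]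
    rw [h1, h2, add_zero]
  rw [laplacian_eq_sum_fderiv hP]
  have h4 : (-2 : ℝ) • ∑ i, D i i = 0 := by
    rw [← h3, Finset.smul_sum]
    refine Finset.sum_congr rfl fun i _ => ?_
    rw [Finset.sum_eq_single i (fun j _ hj => by simp [hj.symm]) (by simp), if_pos rfl,
      Algebra.smul_def]
  exact (smul_eq_zero.1 h4).resolve_left (by norm_num)

theorem IsEvenMonogenicPoly.isSolidHarmonic (hP : IsEvenMonogenicPoly n k P) :
    IsSolidHarmonic k P where
  contDiff := hP.homogeneous.contDiff
  laplacian_eq_zero :=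
    laplacian_eq_zero_of_dirac_eq_zero hP.homogeneous.contDiff hP.monogenic
  fderiv_self := hP.homogeneous.fderiv_self

/-- If `P` is monogenic, then `x P(x)` is harmonic. -/
theorem IsEvenMonogenicPoly.isSolidHarmonic_ι_mul (hP : IsEvenMonogenicPoly n k P) :
    IsSolidHarmonic (k + 1) fun x => CliffordAlgebra.ι (negSq n) x * P x := by
  have hH := hP.isSolidHarmonic
  have hj (j : Fin n) := hH.clm_comp (mulLeftCLM (cliffordGen n j))
  have hs (x : Vec n) : CliffordAlgebra.ι (negSq n) x * P x
      = ∑ j, x j • mulLeftCLM (cliffordGen n j) (P x) := by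
    simp [ι_eq_sum_cliffordGen, Finset.sum_mul]
  have hfd (j : Fin n) (x v : Vec n) :
      fderiv ℝ (fun z => mulLeftCLM (cliffordGen n j) (P z)) x v
        = cliffordGen n j * fderiv ℝ P x v := by
    have h := ((mulLeftCLM (cliffordGen n j)).hasFDerivAt.comp x
      (hH.contDiff.differentiable (by simp) x).hasFDerivAt).fderiv
    exact congrArg (fun T => T v) h
  have hc (j : Fin n) := contDiff_coord_smul (hj j).contDiff j
  simp only [hs]
  refine ⟨ContDiff.sum fun j _ => hc j, fun x => ?_, fun x => ?_⟩
  -- Each `x_j e_j P` has Laplacian `2 e_j ∂_j P`, as `e_j P` is harmonic; the sum is twice the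
  -- Dirac operator applied to `P`.
  · rw [laplacian_fun_sum _ fun j _ => hc j]
    simp only [laplacian_coord_smul (hj _).contDiff, (hj _).laplacian_eq_zero, hfd, smul_zero,
      add_zero]
    rw [← Finset.smul_sum, ← dirac_eq_sum_fderiv (hH.contDiff.differentiable (by simp)),
      hP.monogenic, smul_zero]
  · rw [fderiv_fun_sum fun j _ => (hc j).differentiable (by simp) x, sum_apply,
      Finset.smul_sum]
    refine Finset.sum_congr rfl fun j _ => ?_
    rw [fderiv_coord_smul ((hj j).contDiff.differentiable (by simp)), (hj j).fderiv_self]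
    push_cast
    module

end Monogenic

/-! ### The Laplacian on products of solid harmonics -/

section HarmonicSum

variable {p q : ℕ}

/-- `∑ aᵢⱼ |x|^(2i) |y|^(2j) f(x) g(y)`, the sum over `i + j + 1 = M`. -/
noncomputable def harmonicSum (a : ℕ → ℕ → ℝ) (M : ℕ) (f : Vec p → BiCl p q)
    (g : Vec q → BiCl p q) (x : Vec p) (y : Vec q) : BiCl p q :=
  ∑ i ∈ Finset.range M,
    (a i (M - 1 - i) * (‖x‖ ^ 2) ^ i * (‖y‖ ^ 2) ^ (M - 1 - i)) • (f x * g y)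

/-- The action of the Laplacian on the coefficients of a `harmonicSum` with solid harmonics of
degrees `d` and `e`. -/
noncomputable def lapCoeff (p q d e : ℕ) (a : ℕ → ℕ → ℝ) (i j : ℕ) : ℝ :=
  2 * (i + 1) * (2 * (i + 1) + p - 2 + 2 * d) * a (i + 1) j
    + 2 * (j + 1) * (2 * (j + 1) + q - 2 + 2 * e) * a i (j + 1)

/-- Right multiplication by `b` as a continuous linear map. -/
noncomputable def mulRightCLM (b : BiCl p q) : BiCl p q →L[ℝ] BiCl p q :=
  (LinearMap.mulRight ℝ b).toContinuousLinearMap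

/-- Left multiplication by `b` as a continuous linear map. -/
noncomputable def biMulLeftCLM (b : BiCl p q) : BiCl p q →L[ℝ] BiCl p q :=
  (LinearMap.mulLeft ℝ b).toContinuousLinearMap

theorem IsSolidHarmonic.mul_right {n d : ℕ} {f : Vec n → BiCl p q} (hf : IsSolidHarmonic d f)
    (b : BiCl p q) : IsSolidHarmonic d fun x => f x * b :=
  hf.clm_comp (mulRightCLM b)

theorem IsSolidHarmonic.mul_left {n d : ℕ} {f : Vec n → BiCl p q} (hf : IsSolidHarmonic d f)
    (b : BiCl p q) : IsSolidHarmonic d fun x => b * f x :=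
  hf.clm_comp (biMulLeftCLM b)

section

variable {n d : ℕ} {F : Type*} [NormedAddCommGroup F] [NormedSpace ℝ F] {f : Vec n → F}

theorem IsSolidHarmonic.contDiff_sum (hf : IsSolidHarmonic d f) (b : ℕ → ℝ) (r : ℕ → ℕ)
    (s : Finset ℕ) : ContDiff ℝ ∞ fun x => ∑ i ∈ s, b i • (‖x‖ ^ 2) ^ r i • f x :=
  ContDiff.sum fun i _ => (contDiff_normSq_pow_smul hf.contDiff (r i)).const_smul (b i)

theorem IsSolidHarmonic.laplacian_sum (hf : IsSolidHarmonic d f) (b : ℕ → ℝ) (r : ℕ → ℕ)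
    (s : Finset ℕ) (x : Vec n) :
    Δ (fun x => ∑ i ∈ s, b i • (‖x‖ ^ 2) ^ r i • f x) x
      = ∑ i ∈ s, (b i * (2 * r i * (2 * r i + n - 2 + 2 * d))) • (‖x‖ ^ 2) ^ (r i - 1) • f x := by
  rw [laplacian_fun_sum _ fun i _ => (contDiff_normSq_pow_smul hf.contDiff (r i)).const_smul (b i)]
  refine Finset.sum_congr rfl fun i _ => ?_
  rw [laplacian_fun_const_smul (contDiff_normSq_pow_smul hf.contDiff (r i)),
    hf.laplacian_normSq_pow_smul, smul_smul]

end

variable {d e : ℕ} {f : Vec p → BiCl p q} {g : Vec q → BiCl p q}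

theorem harmonicSum_eq_left (a : ℕ → ℕ → ℝ) (M : ℕ) (y : Vec q) :
    (fun x => harmonicSum a M f g x y) = fun x => ∑ i ∈ Finset.range M,
      (a i (M - 1 - i) * (‖y‖ ^ 2) ^ (M - 1 - i)) • (‖x‖ ^ 2) ^ i • (f x * g y) := by
  funext x
  refine Finset.sum_congr rfl fun i _ => ?_
  rw [smul_smul]
  ring_nf

theorem harmonicSum_eq_right (a : ℕ → ℕ → ℝ) (M : ℕ) (x : Vec p) :
    (fun y => harmonicSum a M f g x y) = fun y => ∑ i ∈ Finset.range M,
      (a i (M - 1 - i) * (‖x‖ ^ 2) ^ i) • (‖y‖ ^ 2) ^ (M - 1 - i) • (f x * g y) := by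
  funext y
  refine Finset.sum_congr rfl fun i _ => ?_
  rw [smul_smul]

theorem contDiff_harmonicSum_left (hf : IsSolidHarmonic d f) (a : ℕ → ℕ → ℝ) (M : ℕ)
    (y : Vec q) : ContDiff ℝ ∞ fun x => harmonicSum a M f g x y := by
  rw [harmonicSum_eq_left]
  exact (hf.mul_right (g y)).contDiff_sum _ _ _

theorem contDiff_harmonicSum_right (hg : IsSolidHarmonic e g) (a : ℕ → ℕ → ℝ) (M : ℕ)
    (x : Vec p) : ContDiff ℝ ∞ fun y => harmonicSum a M f g x y := by
  rw [harmonicSum_eq_right]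
  exact (hg.mul_left (f x)).contDiff_sum _ (fun i => M - 1 - i) _

theorem biLaplacian_harmonicSum (hf : IsSolidHarmonic d f) (hg : IsSolidHarmonic e g)
    (a : ℕ → ℕ → ℝ) (M : ℕ) :
    biLaplacian p q (harmonicSum a M f g)
      = harmonicSum (lapCoeff p q d e a) (M - 1) f g := by
  funext x y
  rw [biLaplacian, harmonicSum_eq_left, harmonicSum_eq_right,
    (hf.mul_right (g y)).laplacian_sum _ (fun i => i),
    (hg.mul_left (f x)).laplacian_sum _ (fun i => M - 1 - i)]
  cases M with
  | zero => simp [harmonicSum]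
  | succ M =>
    -- The `x`-sum loses its term `i = 0` and the `y`-sum its term `j = 0`, both with zero
    -- coefficient; the other terms align after shifting `i` in the `x`-sum.
    rw [Finset.sum_range_succ', Finset.sum_range_succ]
    simp only [Nat.add_sub_cancel, Nat.sub_self, Nat.cast_zero, mul_zero, zero_mul, zero_smul,
      add_zero]
    rw [← Finset.sum_add_distrib, harmonicSum]
    refine Finset.sum_congr rfl fun i hi => ?_
    rw [Finset.mem_range] at hi
    obtain ⟨j, rfl⟩ : ∃ j, M = i + j + 1 := ⟨M - i - 1, by omega⟩
    have e1 : i + j + 1 - (i + 1) = j := by omega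
    have e2 : i + j + 1 - i = j + 1 := by omega
    have e3 : i + j - i = j := by omega
    simp only [e1, e2, e3, lapCoeff, Nat.add_sub_cancel, smul_smul, ← add_smul]
    congr 1
    push_cast
    ring

theorem biLaplacian_add {F₁ F₂ : Vec p → Vec q → BiCl p q}
    (h₁ : ∀ y, ContDiff ℝ ∞ fun x => F₁ x y) (h₂ : ∀ y, ContDiff ℝ ∞ fun x => F₂ x y)
    (h₁' : ∀ x, ContDiff ℝ ∞ fun y => F₁ x y) (h₂' : ∀ x, ContDiff ℝ ∞ fun y => F₂ x y) :
    biLaplacian p q (F₁ + F₂) = biLaplacian p q F₁ + biLaplacian p q F₂ := by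
  funext x y
  simp only [biLaplacian, Pi.add_apply]
  rw [laplacian_fun_add (h₁ y) (h₂ y), laplacian_fun_add (h₁' x) (h₂' x)]
  abel

/-- Additivity of the Laplacian needs smoothness, which persists because every iterate is again a
sum of the same shape. Truncated subtraction keeps an exhausted sum empty. -/
theorem iterate_biLaplacian_harmonicSum_add {d' e' : ℕ} {f' : Vec p → BiCl p q}
    {g' : Vec q → BiCl p q} (hf : IsSolidHarmonic d f) (hg : IsSolidHarmonic e g)
    (hf' : IsSolidHarmonic d' f') (hg' : IsSolidHarmonic e' g') (a b : ℕ → ℕ → ℝ)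
    (M M' m : ℕ) :
    (biLaplacian p q)^[m] (harmonicSum a M f g + harmonicSum b M' f' g')
      = harmonicSum ((lapCoeff p q d e)^[m] a) (M - m) f g
        + harmonicSum ((lapCoeff p q d' e')^[m] b) (M' - m) f' g' := by
  induction m with
  | zero => rfl
  | succ m ih =>
    rw [Function.iterate_succ_apply', ih, biLaplacian_add
      (contDiff_harmonicSum_left hf _ _) (contDiff_harmonicSum_left hf' _ _)
      (contDiff_harmonicSum_right hg _ _) (contDiff_harmonicSum_right hg' _ _),
      biLaplacian_harmonicSum hf hg, biLaplacian_harmonicSum hf' hg',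
      Function.iterate_succ_apply', Function.iterate_succ_apply', Nat.sub_sub, Nat.sub_sub]

theorem iterate_biLaplacian_zero (m : ℕ) :
    (biLaplacian p q)^[m] (0 : Vec p → Vec q → BiCl p q) = 0 := by
  refine Function.iterate_fixed ?_ m
  funext x y
  simp only [biLaplacian, Pi.zero_apply, laplacian_const, add_zero]

end HarmonicSum

/-! ### The seed of the transform for a power `zⁿ` -/

section Seed

theorem complex_mk_pow (a b : ℝ) (n : ℕ) :
    (⟨a, b⟩ : ℂ) ^ n = ∑ m ∈ Finset.range (n + 1),
      ((n.choose m * b ^ m * a ^ (n - m) : ℝ) : ℂ) * Complex.I ^ m := by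
  rw [show (⟨a, b⟩ : ℂ) = (b : ℂ) * Complex.I + a from Complex.ext (by simp) (by simp), add_pow]
  refine Finset.sum_congr rfl fun m _ => ?_
  push_cast
  ring

/-- The factor `c m` stands for `Re iᵐ` or `Im iᵐ`, so that `A` and `B` are treated at once. -/
theorem integral_sum_moments {p : ℕ} (hp : 3 ≤ p) (k n : ℕ) (r ρ : ℝ) (c : ℕ → ℝ) :
    ∫ t in (-1 : ℝ)..1, (∑ m ∈ Finset.range (n + 1),
        (n.choose m * ρ ^ m * (r * t) ^ (n - m)) * c m) * gegen p k t *
          (1 - t ^ 2) ^ (((p : ℝ) - 3) / 2)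
      = ∑ m ∈ Finset.range (n + 1),
        n.choose m * c m * gegenMoment p k (n - m) * (r ^ (n - m) * ρ ^ m) := by
  have h (t : ℝ) : (∑ m ∈ Finset.range (n + 1),
        (n.choose m * ρ ^ m * (r * t) ^ (n - m)) * c m) * gegen p k t *
          (1 - t ^ 2) ^ (((p : ℝ) - 3) / 2)
      = ∑ m ∈ Finset.range (n + 1), (n.choose m * c m * (r ^ (n - m) * ρ ^ m)) *
          (t ^ (n - m) * gegen p k t * gegenWeight p t) := by
    rw [Finset.sum_mul, Finset.sum_mul]
    refine Finset.sum_congr rfl fun m _ => ?_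
    rw [gegenWeight, mul_pow]
    ring
  simp only [h]
  rw [intervalIntegral.integral_finsetSum fun m _ =>
    (gegenMoment_intervalIntegrable hp k (n - m)).const_mul _]
  refine Finset.sum_congr rfl fun m _ => ?_
  rw [intervalIntegral.integral_const_mul, gegenMoment]
  ring

theorem partA_pow {p : ℕ} (hp : 3 ≤ p) (k n : ℕ) (r ρ : ℝ) :
    partA p k (fun z => z ^ n) r ρ = (gegen p k 1)⁻¹ * (r ^ k)⁻¹ *
      ∑ m ∈ Finset.range (n + 1), n.choose m * (Complex.I ^ m).re * gegenMoment p k (n - m) *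
        (r ^ (n - m) * ρ ^ m) := by
  simp only [partA, complex_mk_pow, Complex.re_sum, Complex.re_ofReal_mul]
  rw [integral_sum_moments hp]

theorem partB_pow {p : ℕ} (hp : 3 ≤ p) (k n : ℕ) (r ρ : ℝ) :
    partB p k (fun z => z ^ n) r ρ = (gegen p (k + 1) 1)⁻¹ * (r ^ k)⁻¹ *
      ∑ m ∈ Finset.range (n + 1), n.choose m * (Complex.I ^ m).im *
        gegenMoment p (k + 1) (n - m) * (r ^ (n - m) * ρ ^ m) := by
  simp only [partB, complex_mk_pow, Complex.im_sum, Complex.im_ofReal_mul]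
  rw [integral_sum_moments hp]

theorem I_pow_re_of_odd {m : ℕ} (hm : Odd m) : (Complex.I ^ m).re = 0 := by
  obtain ⟨j, rfl⟩ := hm
  rw [pow_succ, pow_mul, Complex.I_sq, show ((-1 : ℂ)) ^ j = (((-1 : ℝ) ^ j : ℝ) : ℂ) by simp]
  rw [Complex.re_ofReal_mul, Complex.I_re, mul_zero]

theorem I_pow_im_of_even {m : ℕ} (hm : Even m) : (Complex.I ^ m).im = 0 := by
  obtain ⟨j, rfl⟩ := hm
  rw [← two_mul, pow_mul, Complex.I_sq,
    show ((-1 : ℂ)) ^ j = (((-1 : ℝ) ^ j : ℝ) : ℂ) by simp, Complex.ofReal_im]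

variable {p k n : ℕ}

theorem momentA_eq_zero (hp : 3 ≤ p) {m : ℕ} (hm : m ≤ n)
    (h : Odd m ∨ Odd (k + n) ∨ n < m + k) :
    (Complex.I ^ m).re * gegenMoment p k (n - m) = 0 := by
  rcases Nat.even_or_odd m with he | ho
  · rcases h with h | h | h
    · rw [I_pow_re_of_odd h, zero_mul]
    · rw [gegenMoment_of_odd hp (by rw [Nat.odd_iff, Nat.even_iff] at *; omega), mul_zero]
    · rw [gegenMoment_of_lt hp (by omega), mul_zero]
  · rw [I_pow_re_of_odd ho, zero_mul]

theorem momentB_eq_zero (hp : 3 ≤ p) {m : ℕ} (hm : m ≤ n)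
    (h : Even m ∨ Odd (k + n) ∨ n < m + (k + 1)) :
    (Complex.I ^ m).im * gegenMoment p (k + 1) (n - m) = 0 := by
  rcases Nat.even_or_odd m with he | ho
  · rw [I_pow_im_of_even he, zero_mul]
  · rcases h with h | h | h
    · rw [I_pow_im_of_even h, zero_mul]
    · rw [gegenMoment_of_odd hp (by rw [Nat.odd_iff] at *; omega), mul_zero]
    · rw [gegenMoment_of_lt hp (by omega), mul_zero]

theorem partA_pow_of_odd (hp : 3 ≤ p) (h : Odd (k + n)) (r ρ : ℝ) :
    partA p k (fun z => z ^ n) r ρ = 0 := by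
  rw [partA_pow hp, Finset.sum_eq_zero, mul_zero]
  intro m hm
  rw [mul_assoc (n.choose m : ℝ),
    momentA_eq_zero hp (by simpa [Nat.lt_succ_iff] using hm) (.inr (.inl h))]
  ring

theorem partB_pow_of_odd (hp : 3 ≤ p) (h : Odd (k + n)) (r ρ : ℝ) :
    partB p k (fun z => z ^ n) r ρ = 0 := by
  rw [partB_pow hp, Finset.sum_eq_zero, mul_zero]
  intro m hm
  rw [mul_assoc (n.choose m : ℝ),
    momentB_eq_zero hp (by simpa [Nat.lt_succ_iff] using hm) (.inr (.inl h))]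
  ring

/-- The coefficient of `r^(2i) ρ^(2j)` in `A(r, ρ)`. -/
noncomputable def coeffA (p k n : ℕ) (_i j : ℕ) : ℝ :=
  (gegen p k 1)⁻¹ *
    (n.choose (2 * j) * (Complex.I ^ (2 * j)).re * gegenMoment p k (n - 2 * j))

/-- The coefficient of `r^(2i+1) ρ^(2j+1)` in `-B(r, ρ)`. -/
noncomputable def coeffB (p k n : ℕ) (_i j : ℕ) : ℝ :=
  -((gegen p (k + 1) 1)⁻¹ * (n.choose (2 * j + 1) * (Complex.I ^ (2 * j + 1)).im *
    gegenMoment p (k + 1) (n - (2 * j + 1))))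

/-- The surviving indices are `m = 2j` with `n - m = k + 2i`. Their number `(n + 2 - k) / 2` is `(n
- k)/2 + 1` for `k ≤ n` and `0` otherwise. The factor `(r ^ k)⁻¹ * r ^ k` stays because `r` may be
zero. -/
theorem partA_pow_of_even (hp : 3 ≤ p) (h : Even (k + n)) (r ρ : ℝ) :
    partA p k (fun z => z ^ n) r ρ = ((r ^ k)⁻¹ * r ^ k) *
      ∑ i ∈ Finset.range ((n + 2 - k) / 2), coeffA p k n i ((n + 2 - k) / 2 - 1 - i) *
        (r ^ 2) ^ i * (ρ ^ 2) ^ ((n + 2 - k) / 2 - 1 - i) := by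
  rw [Nat.even_iff] at h
  rw [partA_pow hp, ← Finset.sum_of_injOn (s := Finset.range ((n + 2 - k) / 2))
    (f := fun i => n.choose (2 * ((n + 2 - k) / 2 - 1 - i)) *
      (Complex.I ^ (2 * ((n + 2 - k) / 2 - 1 - i))).re *
      gegenMoment p k (n - 2 * ((n + 2 - k) / 2 - 1 - i)) *
        (r ^ (n - 2 * ((n + 2 - k) / 2 - 1 - i)) * ρ ^ (2 * ((n + 2 - k) / 2 - 1 - i))))
    (fun i => 2 * ((n + 2 - k) / 2 - 1 - i)) _ _ _ fun _ _ => rfl]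
  · rw [Finset.mul_sum, Finset.mul_sum]
    refine Finset.sum_congr rfl fun i hi => ?_
    rw [Finset.mem_range] at hi
    have e : n - 2 * ((n + 2 - k) / 2 - 1 - i) = k + 2 * i := by omega
    rw [coeffA, e, pow_add, pow_mul r, pow_mul ρ]
    ring
  · intro i hi j hj hij
    simp only [Finset.coe_range, Set.mem_Iio] at hi hj hij
    omega
  · intro i hi
    simp only [Finset.coe_range, Set.mem_Iio] at hi ⊢
    omega
  · intro m hm hm'
    rw [Finset.mem_range] at hm
    rw [mul_assoc (n.choose m : ℝ), momentA_eq_zero hp (by omega), mul_zero, zero_mul]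
    -- An even `m` with `m + k ≤ n` would lie in the image of the reindexing.
    by_contra! hc
    rw [Nat.not_odd_iff_even, Nat.even_iff] at hc
    refine hm' ⟨(n + 2 - k) / 2 - 1 - m / 2, ?_, ?_⟩
    · simp only [Finset.coe_range, Set.mem_Iio]
      omega
    · simp only
      omega

/-- Here `m = 2j + 1` and `n - m = k + 1 + 2i`, which splits off one factor `rρ`. -/
theorem partB_pow_of_even (hp : 3 ≤ p) (h : Even (k + n)) (r ρ : ℝ) :
    -partB p k (fun z => z ^ n) r ρ = ((r ^ k)⁻¹ * r ^ k) * (r * ρ) *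
      ∑ i ∈ Finset.range ((n - k) / 2), coeffB p k n i ((n - k) / 2 - 1 - i) *
        (r ^ 2) ^ i * (ρ ^ 2) ^ ((n - k) / 2 - 1 - i) := by
  rw [Nat.even_iff] at h
  rw [partB_pow hp, ← Finset.sum_of_injOn (s := Finset.range ((n - k) / 2))
    (f := fun i => n.choose (2 * ((n - k) / 2 - 1 - i) + 1) *
      (Complex.I ^ (2 * ((n - k) / 2 - 1 - i) + 1)).im *
      gegenMoment p (k + 1) (n - (2 * ((n - k) / 2 - 1 - i) + 1)) *
        (r ^ (n - (2 * ((n - k) / 2 - 1 - i) + 1)) * ρ ^ (2 * ((n - k) / 2 - 1 - i) + 1)))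
    (fun i => 2 * ((n - k) / 2 - 1 - i) + 1) _ _ _ fun _ _ => rfl]
  · rw [Finset.mul_sum, Finset.mul_sum, ← Finset.sum_neg_distrib]
    refine Finset.sum_congr rfl fun i hi => ?_
    rw [Finset.mem_range] at hi
    have e : n - (2 * ((n - k) / 2 - 1 - i) + 1) = k + (2 * i + 1) := by omega
    rw [coeffB, e, pow_add r, pow_succ r (2 * i), pow_succ ρ (2 * _), pow_mul r, pow_mul ρ]
    ring
  · intro i hi j hj hij
    simp only [Finset.coe_range, Set.mem_Iio] at hi hj hij
    omega
  · intro i hi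
    simp only [Finset.coe_range, Set.mem_Iio] at hi ⊢
    omega
  · intro m hm hm'
    rw [Finset.mem_range] at hm
    rw [mul_assoc (n.choose m : ℝ), momentB_eq_zero hp (by omega), mul_zero, zero_mul]
    by_contra! hc
    rw [Nat.not_even_iff_odd, Nat.odd_iff] at hc
    refine hm' ⟨(n - k) / 2 - 1 - m / 2, ?_, ?_⟩
    · simp only [Finset.coe_range, Set.mem_Iio]
      omega
    · simp only
      omega

end Seed

/-! ### Clifford algebra identities -/

section Clifford

variable {p q : ℕ}

/-- Composition with the inclusion of the first factor. -/
noncomputable def inclXCLM (p q : ℕ) : Cl p →L[ℝ] BiCl p q :=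
  (inclX p q).toLinearMap.toContinuousLinearMap

/-- Composition with the inclusion of the second factor. -/
noncomputable def inclYCLM (p q : ℕ) : Cl q →L[ℝ] BiCl p q :=
  (inclY p q).toLinearMap.toContinuousLinearMap

theorem inclX_ι (x : Vec p) : inclX p q (CliffordAlgebra.ι (negSq p) x) = vecX p q x :=
  CliffordAlgebra.map_apply_ι _ _

theorem inclY_ι (y : Vec q) : inclY p q (CliffordAlgebra.ι (negSq q) y) = vecY p q y :=
  CliffordAlgebra.map_apply_ι _ _

theorem vecX_sq (x : Vec p) : vecX p q x ^ 2 = algebraMap ℝ (BiCl p q) (-‖x‖ ^ 2) := by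
  rw [sq, vecX, CliffordAlgebra.ι_sq_scalar]
  simp [negSq_apply]

theorem vecY_sq (y : Vec q) : vecY p q y ^ 2 = algebraMap ℝ (BiCl p q) (-‖y‖ ^ 2) := by
  rw [sq, vecY, CliffordAlgebra.ι_sq_scalar]
  simp [negSq_apply]

theorem vecX_smul (c : ℝ) (x : Vec p) : vecX p q (c • x) = c • vecX p q x := by
  rw [← inclX_ι, ← inclX_ι, map_smul, map_smul]

theorem vecY_smul (c : ℝ) (y : Vec q) : vecY p q (c • y) = c • vecY p q y := by
  rw [← inclY_ι, ← inclY_ι, map_smul, map_smul]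

/-- Vectors of `ℝ^q` commute with the even subalgebra of the Clifford algebra of `ℝᵖ`. -/
theorem commute_inclX_vecY {a : Cl p} (ha : a ∈ CliffordAlgebra.even (negSq p)) (y : Vec q) :
    Commute (inclX p q a) (vecY p q y) := by
  rw [← inclY_ι]
  refine CliffordAlgebra.commute_map_mul_map_of_isOrtho_of_mem_evenOdd_zero_left
    _ _ (fun u v => QuadraticMap.IsOrtho.inl_inr (Q₁ := negSq p) (Q₂ := negSq q) u v) _ _ ha
    (i₂ := 1) (CliffordAlgebra.ι_mem_evenOdd_one _ y)

end Clifford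

/-! ### The transform of a power -/

section Transform

variable {p q k n : ℕ} {P : Vec p → Cl p} {P' : Vec q → Cl q}

/-- The scalar differs from `1` only at `x = 0` with `k ≥ 1`, and there `P` vanishes by homogeneity.
-/
theorem IsHomogeneousPoly.inv_mul_norm_pow_smul (hP : IsHomogeneousPoly p k P) (x : Vec p) :
    ((‖x‖ ^ k)⁻¹ * ‖x‖ ^ k) • P x = P x := by
  rcases eq_or_ne (‖x‖ ^ k) 0 with h | h
  · obtain ⟨hx, hk⟩ := pow_eq_zero_iff'.1 h
    have h0 := hP.map_smul 0 x
    rw [zero_pow hk, zero_smul, zero_smul] at h0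
    rw [norm_eq_zero.1 hx, h0, smul_zero]
  · rw [inv_mul_cancel₀ h, one_smul]

theorem norm_smul_inv_norm_smul {m : ℕ} (x : Vec m) : ‖x‖ • ‖x‖⁻¹ • x = x := by
  rcases eq_or_ne x 0 with rfl | h
  · simp
  · rw [smul_smul, mul_inv_cancel₀ (norm_ne_zero_iff.2 h), one_smul]

theorem ffhSeed_pow_of_odd (hp : 3 ≤ p) (h : Odd (k + n)) :
    ffhSeed p q k (fun z => z ^ n) P P' = 0 := by
  funext x y
  simp [ffhSeed, partA_pow_of_odd hp h, partB_pow_of_odd hp h]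

/-- Only the evenness of `P` matters: it lets `y` pass `P(x)`. -/
theorem vecX_mul_vecY_mul (hP : IsEvenMonogenicPoly p k P) (x : Vec p) (y : Vec q) :
    vecX p q x * vecY p q y * (inclX p q (P x) * inclY p q (P' y))
      = inclX p q (CliffordAlgebra.ι (negSq p) x * P x)
        * inclY p q (CliffordAlgebra.ι (negSq q) y * P' y) := by
  rw [map_mul, map_mul, inclX_ι, inclY_ι, mul_assoc, mul_assoc,
    ← mul_assoc (vecY p q y), ← (commute_inclX_vecY (hP.even x) y).eq, mul_assoc]

/-- The identity holds at every point, including `x = 0`, so the iterated Laplacian acts on a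
polynomial. -/
theorem ffhSeed_pow_of_even (hp : 3 ≤ p) (h : Even (k + n)) (hP : IsEvenMonogenicPoly p k P) :
    ffhSeed p q k (fun z => z ^ n) P P'
      = harmonicSum (coeffA p k n) ((n + 2 - k) / 2) (fun x => inclX p q (P x))
          (fun y => inclY p q (P' y))
        + harmonicSum (coeffB p k n) ((n - k) / 2)
          (fun x => inclX p q (CliffordAlgebra.ι (negSq p) x * P x))
          (fun y => inclY p q (CliffordAlgebra.ι (negSq q) y * P' y)) := by
  funext x y
  have hr (c : ℝ) (b : BiCl p q) : (((‖x‖ ^ k)⁻¹ * ‖x‖ ^ k) * c) • (inclX p q (P x) * b)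
      = c • (inclX p q (P x) * b) := by
    rw [mul_comm, mul_smul, ← smul_mul_assoc (_ * _), ← map_smul,
      hP.homogeneous.inv_mul_norm_pow_smul]
  have hxy : (‖x‖ * ‖y‖) • (vecX p q (‖x‖⁻¹ • x) * vecY p q (‖y‖⁻¹ • y))
      = vecX p q x * vecY p q y := by
    rw [mul_smul, ← mul_smul_comm, ← smul_mul_assoc, ← vecX_smul, ← vecY_smul,
      norm_smul_inv_norm_smul, norm_smul_inv_norm_smul]
  have hB (c : ℝ) (b : BiCl p q) : (((‖x‖ ^ k)⁻¹ * ‖x‖ ^ k) * (‖x‖ * ‖y‖) * c) •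
      (vecX p q (‖x‖⁻¹ • x) * vecY p q (‖y‖⁻¹ • y)) * (inclX p q (P x) * b)
      = c • (vecX p q x * vecY p q y * (inclX p q (P x) * b)) := by
    rw [mul_right_comm, mul_smul, hxy, smul_mul_assoc, ← mul_smul_comm, hr, mul_smul_comm]
  rw [ffhSeed, sub_eq_add_neg, ← neg_smul, partA_pow_of_even hp h, partB_pow_of_even hp h, add_mul,
    ← Algebra.smul_def, hr, hB, vecX_mul_vecY_mul hP, Finset.sum_smul, Finset.sum_smul]
  rfl

/-- The polynomial `∑ aᵢⱼ (-X²)ⁱ (-Y²)ʲ`, the sum over `i + j + 1 = M`. -/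
noncomputable def radialPoly (a : ℕ → ℕ → ℝ) (M : ℕ) : FreeAlgebra ℝ (Fin 2) :=
  ∑ i ∈ Finset.range M, a i (M - 1 - i) •
    ((-FreeAlgebra.ι ℝ 0 ^ 2) ^ i * (-FreeAlgebra.ι ℝ 1 ^ 2) ^ (M - 1 - i))

theorem ι_mem_homogeneousPart (j : Fin 2) : FreeAlgebra.ι ℝ j ∈ homogeneousPart 1 := by
  rw [homogeneousPart, pow_one]
  exact Submodule.subset_span ⟨j, rfl⟩

theorem mul_mem_homogeneousPart {c d : ℕ} {a b : FreeAlgebra ℝ (Fin 2)}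
    (ha : a ∈ homogeneousPart c) (hb : b ∈ homogeneousPart d) :
    a * b ∈ homogeneousPart (c + d) := by
  rw [homogeneousPart, pow_add]
  exact Submodule.mul_mem_mul ha hb

theorem pow_mem_homogeneousPart {d : ℕ} {a : FreeAlgebra ℝ (Fin 2)}
    (ha : a ∈ homogeneousPart d) (i : ℕ) : a ^ i ∈ homogeneousPart (d * i) := by
  rw [homogeneousPart, pow_mul]
  exact Submodule.pow_mem_pow _ ha i

theorem radialPoly_mem (a : ℕ → ℕ → ℝ) (M : ℕ) :
    radialPoly a M ∈ homogeneousPart (2 * (M - 1)) := by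
  refine Submodule.sum_mem _ fun i hi => Submodule.smul_mem _ _ ?_
  have hi := Finset.mem_range.1 hi
  have h (j : Fin 2) (r : ℕ) : (-FreeAlgebra.ι ℝ j ^ 2) ^ r ∈ homogeneousPart (2 * r) :=
    pow_mem_homogeneousPart
      (Submodule.neg_mem _ (pow_mem_homogeneousPart (ι_mem_homogeneousPart j) 2)) r
  rw [show 2 * (M - 1) = 2 * i + 2 * (M - 1 - i) by omega]
  exact mul_mem_homogeneousPart (h 0 i) (h 1 _)

theorem evalVec_radialPoly_mul (a : ℕ → ℕ → ℝ) (M : ℕ) (f : Vec p → BiCl p q)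
    (g : Vec q → BiCl p q) (x : Vec p) (y : Vec q) :
    evalVec p q (radialPoly a M) x y * (f x * g y) = harmonicSum a M f g x y := by
  simp only [evalVec, radialPoly, harmonicSum, map_sum, map_smul, map_mul, map_pow, map_neg,
    FreeAlgebra.lift_ι_apply, Finset.sum_mul]
  refine Finset.sum_congr rfl fun i _ => ?_
  simp only [Matrix.cons_val_zero, Matrix.cons_val_one, vecX_sq, vecY_sq, ← map_neg, neg_neg,
    ← map_pow, ← map_mul]
  rw [smul_mul_assoc, ← Algebra.smul_def, smul_smul, mul_assoc]

end Transform

theorem mainTheorem3 (p q k l n : ℕ) (hp : 3 ≤ p) (hq : Odd q) :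
    (Odd ((k : ℤ) - (n : ℤ)) →
      ∀ (P : Vec p → Cl p) (P' : Vec q → Cl q),
        IsEvenMonogenicPoly p k P → IsEvenMonogenicPoly q l P' →
        ∀ (x : Vec p) (y : Vec q), y ≠ 0 →
          Ft p q k l (fun z => z ^ n) P P' x y = 0) ∧
    (Even ((k : ℤ) - (n : ℤ)) →
      ∃ H : FreeAlgebra ℝ (Fin 2),
        (k + 2 * l + q - 1 ≤ n → H ∈ homogeneousPart (n - (k + 2 * l + q - 1))) ∧
        (n < k + 2 * l + q - 1 → H = 0) ∧
        ∀ (P : Vec p → Cl p) (P' : Vec q → Cl q),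
          IsEvenMonogenicPoly p k P → IsEvenMonogenicPoly q l P' →
          ∀ (x : Vec p) (y : Vec q), y ≠ 0 →
            Ft p q k l (fun z => z ^ n) P P' x y =
              evalVec p q H x y * (inclX p q (P x) * inclY p q (P' y))) := by
  refine ⟨fun h P P' _ _ x y _ => ?_, fun h => ?_⟩
  · have h' : Odd (k + n) := by rw [Int.odd_iff] at h; rw [Nat.odd_iff]; omega
    rw [Ft, ffhSeed_pow_of_odd hp h', iterate_biLaplacian_zero]
    rfl
  have h' : Even (k + n) := by rw [Int.even_iff] at h; rw [Nat.even_iff]; omega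
  have hmod := Nat.even_iff.1 h'
  have hq' := Nat.odd_iff.1 hq
  set m := l + (q - 1) / 2 with hm
  -- Since `2m = 2l + q - 1`, the number `M` is zero exactly when `n < k + 2l + q - 1`, and `M' = M
  -- - 1` in truncated subtraction.
  set M := (n + 2 - k) / 2 - m with hM
  set M' := (n - k) / 2 - m with hM'
  set a := (lapCoeff p q k l)^[m] (coeffA p k n)
  set b := (lapCoeff p q (k + 1) (l + 1))^[m] (coeffB p k n)
  -- The factor `XY` in the second summand comes from `(xP)(yP') = xy PP'`.
  refine ⟨radialPoly a M + radialPoly b M' * (FreeAlgebra.ι ℝ 0 * FreeAlgebra.ι ℝ 1),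
    fun hn => ?_, fun hn => ?_, fun P P' hP hP' x y _ => ?_⟩
  · refine Submodule.add_mem _ ?_ ?_
    · rw [show n - (k + 2 * l + q - 1) = 2 * (M - 1) by omega]
      exact radialPoly_mem a M
    -- For `M' = 0` the second summand is zero; the degree count `2(M' - 1) + 2` would be wrong
    -- there.
    · rcases Nat.eq_zero_or_pos M' with h0 | h0
      · rw [h0]
        simp [radialPoly]
      · rw [show n - (k + 2 * l + q - 1) = 2 * (M' - 1) + (1 + 1) by omega]
        exact mul_mem_homogeneousPart (radialPoly_mem b M')
          (mul_mem_homogeneousPart (ι_mem_homogeneousPart 0) (ι_mem_homogeneousPart 1))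
  · rw [show M = 0 by omega, show M' = 0 by omega]
    simp [radialPoly]
  · have hf := hP.isSolidHarmonic.clm_comp (inclXCLM p q)
    have hg := hP'.isSolidHarmonic.clm_comp (inclYCLM p q)
    have hf' := hP.isSolidHarmonic_ι_mul.clm_comp (inclXCLM p q)
    have hg' := hP'.isSolidHarmonic_ι_mul.clm_comp (inclYCLM p q)
    have hFt := congrFun (congrFun (iterate_biLaplacian_harmonicSum_add hf hg hf' hg'
      (coeffA p k n) (coeffB p k n) ((n + 2 - k) / 2) ((n - k) / 2) m) x) y
    rw [Ft, ffhSeed_pow_of_even hp h' hP]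
    refine hFt.trans ?_
    rw [Pi.add_apply, Pi.add_apply, ← evalVec_radialPoly_mul, ← evalVec_radialPoly_mul]
    have he : evalVec p q (radialPoly a M + radialPoly b M' *
        (FreeAlgebra.ι ℝ 0 * FreeAlgebra.ι ℝ 1)) x y = evalVec p q (radialPoly a M) x y
          + evalVec p q (radialPoly b M') x y * (vecX p q x * vecY p q y) := by
      simp [evalVec]
    rw [he, add_mul, mul_assoc (evalVec p q (radialPoly b M') x y), vecX_mul_vecY_mul hP]
    rfl
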